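/- A polytope in $\mathbb{R}^n$ is the convex hull of a finite set of points, and a $4$-polytope is a polytope whose affine hull has dimension $4$. The graph $G(P)$ of a polytope $P$ is the undirected graph whose vertices are the vertices ($0$-dimensional faces) of $P$, two distinct vertices being adjacent when the segment joining them is an edge ($1$-dimensional face) of $P$. A graph is $k$-linked if it has at least $2k$ vertices and, for every choice of $2k$ pairwise distinct vertices $s_1,\dots,s_k,t_1,\dots,t_k$, there are pairwise vertex-disjoint paths $L_1,\dots,L_k$ such that $L_i$ joins $s_i$ to $t_i$ for $i=1,\dots,k$. **Proposition (2-linkedness of 4-polytopes).** For every $n$, the graph of every $4$-polytope $P\subset\mathbb{R}^n$ is $2$-linked. -/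

import Mathlib

/-- A convex polytope in `ℝⁿ`: the convex hull of a finite set of points. -/
def IsPolytope {n : ℕ} (P : Set (EuclideanSpace ℝ (Fin n))) : Prop :=
  ∃ S : Finset (EuclideanSpace ℝ (Fin n)), P = convexHull ℝ (S : Set (EuclideanSpace ℝ (Fin n)))

/-- A `d`-polytope: a nonempty polytope whose affine hull has dimension `d`. -/
def IsDPolytope {n : ℕ} (d : ℕ) (P : Set (EuclideanSpace ℝ (Fin n))) : Prop :=
  IsPolytope P ∧ P.Nonempty ∧ Module.finrank ℝ (affineSpan ℝ P).direction = d

/-- The graph `G(P)` of a polytope `P`. The faces of `P` are its exposed subsets (the sets of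
maximisers over `P` of a linear functional, and the empty set). The vertices of the graph are the
points `v` such that `{v}` is a face of `P`; two distinct vertices `v`, `w` are adjacent when the
segment `[v, w]` is a face (an edge) of `P`. -/
def polytopeGraph {n : ℕ} (P : Set (EuclideanSpace ℝ (Fin n))) :
    SimpleGraph {v : EuclideanSpace ℝ (Fin n) // v ∈ P ∧ IsExposed ℝ P {v}} where
  Adj v w := v ≠ w ∧ IsExposed ℝ P (segment ℝ v.1 w.1)
  symm := ⟨fun v w h => ⟨h.1.symm, segment_symm ℝ v.1 w.1 ▸ h.2⟩⟩
  loopless := ⟨fun _ h => h.1 rfl⟩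

/-- `k`-linkedness of a graph: it has at least `2k` vertices and, for all `2k` pairwise distinct
vertices `s₁, …, sₖ, t₁, …, tₖ` (that is, for every pairing of every set of exactly `2k`
vertices), there are pairwise vertex-disjoint paths joining `sᵢ` to `tᵢ`. -/
def SimpleGraph.IsKLinked {V : Type*} (G : SimpleGraph V) (k : ℕ) : Prop :=
  ((2 * k : ℕ) : ℕ∞) ≤ ENat.card V ∧
    ∀ s t : Fin k → V, Function.Injective (Sum.elim s t) →
      ∃ p : (i : Fin k) → G.Walk (s i) (t i),
        (∀ i, (p i).IsPath) ∧
        ∀ i j, i ≠ j → List.Disjoint (p i).support (p j).support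

/-! Some hyperplane H weakly separates the pair s₁, t₁ from the pair s₂, t₂ and has vertices of P
strictly on both sides (`exists_separating_hyperplane`). If the two segments are disjoint, this is
Hahn–Banach. If they meet, they lie in a common plane, which together with the centroid of the
vertices spans an affine space of dimension at most 3. As dim P = 4, a nonconstant functional is
constant on that space, and the centroid forces it to take both larger and smaller values at
vertices. On each side of H, simplex pivots (`exists_edge_of_lt`) climb from both ends of the pair
to a common top vertex (`IsPolytope.exists_isPath_halfSpace`). The resulting path touches H at most
in its own ends, so the two paths are disjoint. -/

section Perturbation

variable {E : Type*} [NormedAddCommGroup E] [NormedSpace ℝ E] [FiniteDimensional ℝ E]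

/-- A functional can be perturbed to be injective on a finite set without reversing any strict
inequality between its values on that set. -/
theorem exists_perturbation_injOn (f : StrongDual ℝ E) (Q : Finset E) :
    ∃ g : StrongDual ℝ E, Set.InjOn g (Q : Set E) ∧
      ∀ a ∈ Q, ∀ b ∈ Q, f a < f b → g a < g b := by
  obtain ⟨g₀, hg₀⟩ := Module.exists_dual_forall_apply_ne_zero (K := ℝ) (M := E)
    (fun p : {p : Q × Q // p.1 ≠ p.2} => (p.1.1 : E) - p.1.2)
    (fun p => sub_ne_zero.2 fun h => p.2 (Subtype.ext h))
  set g : StrongDual ℝ E := LinearMap.toContinuousLinearMap g₀ with hgdef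
  have hg : ∀ a ∈ Q, ∀ b ∈ Q, a ≠ b → g a ≠ g b := by
    intro a ha b hb hab h
    refine hg₀ ⟨(⟨a, ha⟩, ⟨b, hb⟩), fun h => hab (congrArg Subtype.val h)⟩ ?_
    simpa [hgdef, sub_eq_zero] using h
  have key : ∀ a ∈ Q, ∀ b ∈ Q, ∀ᶠ ε in nhdsWithin (0 : ℝ) {0}ᶜ,
      (a ≠ b → f a + ε * g a ≠ f b + ε * g b) ∧
      (f a < f b → f a + ε * g a < f b + ε * g b) := by
    intro a ha b hb
    have hlt : ∀ x y : E, f x < f y →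
        ∀ᶠ ε in nhdsWithin (0 : ℝ) {0}ᶜ, f x + ε * g x < f y + ε * g y := by
      intro x y h
      refine Filter.Eventually.filter_mono nhdsWithin_le_nhds ?_
      exact ContinuousAt.eventually_lt (by fun_prop) (by fun_prop) (by simpa using h)
    rcases lt_trichotomy (f a) (f b) with h | h | h
    · filter_upwards [hlt a b h] with ε hε
      exact ⟨fun _ => hε.ne, fun _ => hε⟩
    · filter_upwards [self_mem_nhdsWithin] with ε hε
      refine ⟨fun hab => ?_, fun h' => absurd h h'.ne⟩
      rw [h]
      intro h'
      exact hg a ha b hb hab (mul_left_cancel₀ hε (add_left_cancel h'))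
    · filter_upwards [hlt b a h] with ε hε
      exact ⟨fun _ => hε.ne', fun h' => absurd h' h.le.not_gt⟩
  have hall := (Filter.eventually_all_finset Q).2 fun a ha =>
    (Filter.eventually_all_finset Q).2 fun b hb => key a ha b hb
  obtain ⟨ε, hε⟩ := hall.exists
  refine ⟨f + ε • g, fun a ha b hb hab => ?_, fun a ha b hb hab => ?_⟩
  · by_contra hne
    exact (hε a ha b hb).1 hne (by simpa using hab)
  · simpa using (hε a ha b hb).2 hab

end Perturbation

/-! ### Exposed faces and the simplex pivot -/

section Faces

variable {E : Type*} [NormedAddCommGroup E] [NormedSpace ℝ E]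

/-- A functional bounded by `r` on the extreme points of a compact convex set is bounded by `r`
on the whole set. -/
theorem le_of_forall_extremePoints_le {P : Set E} (hc : IsCompact P) (hconv : Convex ℝ P)
    (l : StrongDual ℝ E) {r : ℝ} (h : ∀ x ∈ P.extremePoints ℝ, l x ≤ r) {y : E} (hy : y ∈ P) :
    l y ≤ r := by
  rw [← closure_convexHull_extremePoints hc hconv] at hy
  refine closure_minimal (convexHull_min h ?_) ?_ hy
  · exact convex_halfSpace_le l.isLinear r
  · exact isClosed_le l.continuous continuous_const

/-- The face where `l` is maximal is the closed hull of its own extreme points; these are extreme in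
`P`, hence only `v` and `w`. The case `v = w` gives exposed vertices. -/
theorem isExposed_segment_of_extremePoints {P : Set E} (hc : IsCompact P) (hconv : Convex ℝ P)
    (l : StrongDual ℝ E) {v w : E} (hv : v ∈ P) (hw : w ∈ P) (hvw : l w = l v)
    (h : ∀ x ∈ P.extremePoints ℝ, l x ≤ l v)
    (heq : ∀ x ∈ P.extremePoints ℝ, l x = l v → x = v ∨ x = w) :
    IsExposed ℝ P (segment ℝ v w) := by
  intro _
  refine ⟨l, ?_⟩
  have hle : ∀ y ∈ P, l y ≤ l v := fun y hy => le_of_forall_extremePoints_le hc hconv l h hy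
  have hF : IsExposed ℝ P (l.toExposed P) := ContinuousLinearMap.toExposed.isExposed
  change _ = l.toExposed P
  apply Set.Subset.antisymm
  · refine (hF.convex hconv).segment_subset ⟨hv, hle⟩ ⟨hw, fun y hy => hvw ▸ hle y hy⟩
  · rw [← closure_convexHull_extremePoints (hF.isCompact hc) (hF.convex hconv)]
    have hcl : IsClosed (segment ℝ v w) := by
      rw [← convexHull_pair]
      exact (Set.toFinite {v, w}).isClosed_convexHull ℝ
    refine closure_minimal (convexHull_min ?_ (convex_segment v w)) hcl
    intro x hx
    have hx' := hF.isExtreme.extremePoints_subset_extremePoints hx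
    have hxl : l x = l v := le_antisymm (hle x hx'.1) (hx.1.2 v hv)
    rcases heq x hx' hxl with rfl | rfl
    · exact left_mem_segment ℝ _ _
    · exact right_mem_segment ℝ _ _

/-- An extreme point is not in the hull of the other generators, so Hahn–Banach separates it from
them. -/
theorem exists_lt_of_mem_extremePoints_convexHull (S : Finset E) {v : E}
    (hv : v ∈ (convexHull ℝ (S : Set E)).extremePoints ℝ) :
    ∃ l : StrongDual ℝ E, ∀ w ∈ (convexHull ℝ (S : Set E)).extremePoints ℝ, w ≠ v → l w < l v := by
  have hv' : v ∉ convexHull ℝ ((S : Set E) \ {v}) := by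
    intro h
    have := inter_extremePoints_subset_extremePoints_of_subset
      (convexHull_mono (𝕜 := ℝ) Set.sdiff_subset) ⟨h, hv⟩
    exact (extremePoints_convexHull_subset this).2 rfl
  obtain ⟨l, r, hr, hrv⟩ := geometric_hahn_banach_closed_point (convex_convexHull ℝ _)
    ((S.finite_toSet.subset Set.sdiff_subset).isClosed_convexHull ℝ) hv'
  exact ⟨l, fun w hw hne => (hr w (subset_convexHull ℝ _
    ⟨extremePoints_convexHull_subset hw, hne⟩)).trans hrv⟩

theorem isExposed_singleton_iff_mem_extremePoints_convexHull (S : Finset E) {v : E} :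
    v ∈ convexHull ℝ (S : Set E) ∧ IsExposed ℝ (convexHull ℝ (S : Set E)) {v} ↔
      v ∈ (convexHull ℝ (S : Set E)).extremePoints ℝ := by
  refine ⟨fun h => exposedPoints_subset_extremePoints
    (mem_exposedPoints_iff_exposed_singleton.2 h.2), fun h => ⟨h.1, ?_⟩⟩
  obtain ⟨l, hl⟩ := exists_lt_of_mem_extremePoints_convexHull S h
  rw [← segment_same ℝ v]
  refine isExposed_segment_of_extremePoints (S.finite_toSet.isCompact_convexHull ℝ)
    (convex_convexHull ℝ _) l h.1 h.1 rfl (fun x hx => ?_) (fun x hx hxv => ?_)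
  · by_cases hxv : x = v
    · rw [hxv]
    · exact (hl x hx hxv).le
  · by_contra hne
    exact (hl x hx fun h => hne (Or.inl h)).ne hxv

/-- Distinct extreme points of a set lie on distinct rays from any other extreme point. -/
theorem eq_of_smul_sub_eq_smul_sub {P : Set E} {v w x : E} (hv : v ∈ P.extremePoints ℝ)
    (hw : w ∈ P.extremePoints ℝ) (hx : x ∈ P.extremePoints ℝ) (hwv : w ≠ v) (hxv : x ≠ v)
    {a b : ℝ} (ha : 0 < a) (hb : 0 < b) (h : a • (w - v) = b • (x - v)) : w = x := by
  wlog hab : a ≤ b generalizing w x a b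
  · exact (this hx hw hxv hwv hb ha h.symm (not_le.1 hab).le).symm
  rcases hab.eq_or_lt with rfl | hlt
  · simpa using smul_right_injective E ha.ne' h
  · exfalso
    refine hxv ?_
    have hmem : x ∈ openSegment ℝ v w := by
      refine ⟨1 - a / b, a / b, sub_pos.2 ((div_lt_one hb).2 hlt), div_pos ha hb, by ring, ?_⟩
      have h1 : (a / b) • (w - v) = x - v := by
        rw [div_eq_inv_mul, mul_smul, h, smul_smul, inv_mul_cancel₀ hb.ne', one_smul]
      rw [sub_smul, one_smul, sub_add, ← smul_sub, ← neg_sub w v, smul_neg, h1]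
      abel
    exact (hx.2 hv.1 hw.1 hmem).symm

/-- The pivot step of the simplex method: a vertex of a polytope that does not maximise `f` lies
on an edge along which `f` increases. -/
theorem exists_edge_of_lt [FiniteDimensional ℝ E] (S : Finset E) {P : Set E}
    (hP : P = convexHull ℝ (S : Set E)) (f : StrongDual ℝ E) {v u : E}
    (hv : v ∈ P.extremePoints ℝ) (hu : u ∈ P.extremePoints ℝ) (hvu : f v < f u) :
    ∃ w ∈ P.extremePoints ℝ, f v < f w ∧ IsExposed ℝ P (segment ℝ v w) := by
  classical
  subst hP
  set P := convexHull ℝ (S : Set E) with hPdef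
  obtain ⟨l, hl⟩ := exists_lt_of_mem_extremePoints_convexHull S hv
  have hfin : (P.extremePoints ℝ).Finite :=
    S.finite_toSet.subset extremePoints_convexHull_subset
  let W : Finset E := hfin.toFinset.erase v
  have hW : ∀ w, w ∈ W ↔ w ≠ v ∧ w ∈ P.extremePoints ℝ := fun w => by simp [W]
  have hlW : ∀ w ∈ W, 0 < l v - l w := fun w hw =>
    sub_pos.2 (hl w ((hW w).1 hw).2 ((hW w).1 hw).1)
  -- Vertex figure at `v`: directions to the other vertices, scaled so that `l (q w) = -1`.
  let q : E → E := fun w => (l v - l w)⁻¹ • (w - v)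
  obtain ⟨g, hginj, hg⟩ := exists_perturbation_injOn f (W.image q)
  have huW : u ∈ W := (hW u).2 ⟨fun h => by simp [h] at hvu, hu⟩
  obtain ⟨w, hwW, hmax⟩ := W.exists_max_image (fun w => g (q w)) ⟨u, huW⟩
  have hqinj : ∀ x ∈ W, q x = q w → x = w := fun x hx h =>
    eq_of_smul_sub_eq_smul_sub hv ((hW x).1 hx).2 ((hW w).1 hwW).2 ((hW x).1 hx).1
      ((hW w).1 hwW).1 (inv_pos.2 (hlW x hx)) (inv_pos.2 (hlW w hwW)) h
  have hfq : ∀ (f : StrongDual ℝ E), ∀ x ∈ W, (l v - l x) * f (q x) = f x - f v := by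
    intro f x hx
    simp only [q, map_smul, map_sub, smul_eq_mul]
    rw [mul_inv_cancel_left₀ (hlW x hx).ne']
  have hfw : f v < f w := by
    have h1 : f (q u) ≤ f (q w) := by
      by_contra hlt
      exact (hmax u huW).not_gt (hg _ (Finset.mem_image_of_mem q hwW) _
        (Finset.mem_image_of_mem q huW) (not_le.1 hlt))
    have h2 : 0 < f (q u) := by
      refine pos_of_mul_pos_right ?_ (hlW u huW).le
      rw [hfq f u huW]
      exact sub_pos.2 hvu
    exact sub_pos.1 (hfq f w hwW ▸ mul_pos (hlW w hwW) (h2.trans_le h1))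
  refine ⟨w, ((hW w).1 hwW).2, hfw, ?_⟩
  -- The multiple of `l` is chosen so that `m w = m v`; maximality of `g (q w)` makes `m`
  -- supporting.
  let m : StrongDual ℝ E := g + g (q w) • l
  have hm : ∀ x ∈ W, m x - m v = (l v - l x) * (g (q x) - g (q w)) := by
    intro x hx
    simp only [m, add_apply, smul_apply, smul_eq_mul]
    linear_combination -hfq g x hx
  refine isExposed_segment_of_extremePoints (S.finite_toSet.isCompact_convexHull ℝ)
    (convex_convexHull ℝ _) m hv.1 ((hW w).1 hwW).2.1 ?_ (fun x hx => ?_) (fun x hx hxv => ?_)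
  · have := hm w hwW
    rw [sub_self, mul_zero] at this
    exact sub_eq_zero.1 this
  · by_cases hxv : x = v
    · rw [hxv]
    · have hxW := (hW x).2 ⟨hxv, hx⟩
      have := mul_nonpos_of_nonneg_of_nonpos (hlW x hxW).le (sub_nonpos.2 (hmax x hxW))
      linarith [hm x hxW]
  · by_cases hxv' : x = v
    · exact Or.inl hxv'
    · have hxW := (hW x).2 ⟨hxv', hx⟩
      have h0 := hm x hxW
      rw [hxv, sub_self, eq_comm, mul_eq_zero, or_iff_right (hlW x hxW).ne', sub_eq_zero] at h0
      exact Or.inr (hqinj x hxW (hginj (Finset.mem_image_of_mem q hxW)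
        (Finset.mem_image_of_mem q hwW) h0))

end Faces

/-! ### Monotone paths in the graph -/

section Graph

variable {n : ℕ} {P : Set (EuclideanSpace ℝ (Fin n))}

theorem IsPolytope.mem_vertices_iff (hP : IsPolytope P) {v : EuclideanSpace ℝ (Fin n)} :
    v ∈ P ∧ IsExposed ℝ P {v} ↔ v ∈ P.extremePoints ℝ := by
  obtain ⟨S, rfl⟩ := hP
  exact isExposed_singleton_iff_mem_extremePoints_convexHull S

theorem IsPolytope.finite_vertices (hP : IsPolytope P) :
    Finite {v : EuclideanSpace ℝ (Fin n) // v ∈ P ∧ IsExposed ℝ P {v}} := by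
  simp only [hP.mem_vertices_iff]
  obtain ⟨S, rfl⟩ := hP
  exact (S.finite_toSet.subset extremePoints_convexHull_subset).to_subtype

theorem IsPolytope.exists_adj_of_lt (hP : IsPolytope P)
    (f : StrongDual ℝ (EuclideanSpace ℝ (Fin n)))
    {v u : {v : EuclideanSpace ℝ (Fin n) // v ∈ P ∧ IsExposed ℝ P {v}}} (h : f v < f u) :
    ∃ w, (polytopeGraph P).Adj v w ∧ f v < f w := by
  obtain ⟨S, hS⟩ := id hP
  obtain ⟨w, hw, hfw, he⟩ := exists_edge_of_lt S hS f (hP.mem_vertices_iff.1 v.2)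
    (hP.mem_vertices_iff.1 u.2) h
  exact ⟨⟨w, hP.mem_vertices_iff.2 hw⟩, ⟨fun h => by simp [h] at hfw, he⟩, hfw⟩

/-- Two vertices in a closed half-space that is not supporting are joined by a path whose inner
vertices lie in the open half-space. -/
theorem IsPolytope.exists_isPath_halfSpace (hP : IsPolytope P)
    (f : StrongDual ℝ (EuclideanSpace ℝ (Fin n))) (c : ℝ)
    {s t u : {v : EuclideanSpace ℝ (Fin n) // v ∈ P ∧ IsExposed ℝ P {v}}}
    (hs : c ≤ f s) (ht : c ≤ f t) (hu : c < f u) :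
    ∃ p : (polytopeGraph P).Walk s t, p.IsPath ∧ ∀ x ∈ p.support, x = s ∨ x = t ∨ c < f x := by
  classical
  have := hP.finite_vertices
  have := Fintype.ofFinite {v : EuclideanSpace ℝ (Fin n) // v ∈ P ∧ IsExposed ℝ P {v}}
  obtain ⟨g, hginj, hg⟩ := exists_perturbation_injOn f
    (Finset.univ.image (Subtype.val :
      {v : EuclideanSpace ℝ (Fin n) // v ∈ P ∧ IsExposed ℝ P {v}} → _))
  have hmem : ∀ x : {v : EuclideanSpace ℝ (Fin n) // v ∈ P ∧ IsExposed ℝ P {v}},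
      x.1 ∈ Finset.univ.image (Subtype.val :
        {v : EuclideanSpace ℝ (Fin n) // v ∈ P ∧ IsExposed ℝ P {v}} → _) :=
    fun x => Finset.mem_image_of_mem _ (Finset.mem_univ x)
  have hle : ∀ x y : {v : EuclideanSpace ℝ (Fin n) // v ∈ P ∧ IsExposed ℝ P {v}},
      g x ≤ g y → f x ≤ f y := fun x y h => by
    by_contra hlt
    exact h.not_gt (hg _ (hmem y) _ (hmem x) (not_le.1 hlt))
  obtain ⟨m, -, hm⟩ := Finset.univ.exists_max_image
    (fun x : {v : EuclideanSpace ℝ (Fin n) // v ∈ P ∧ IsExposed ℝ P {v}} => g x)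
    ⟨s, Finset.mem_univ s⟩
  have hstrict : ∀ v : {v : EuclideanSpace ℝ (Fin n) // v ∈ P ∧ IsExposed ℝ P {v}}, c < f v →
      ∃ p : (polytopeGraph P).Walk v m, ∀ x ∈ p.support, c < f x := by
    have hwf : WellFounded fun x y :
        {v : EuclideanSpace ℝ (Fin n) // v ∈ P ∧ IsExposed ℝ P {v}} => g y < g x :=
      haveI : IsTrans {v : EuclideanSpace ℝ (Fin n) // v ∈ P ∧ IsExposed ℝ P {v}}
        (fun x y => g y < g x) := ⟨fun _ _ _ h₁ h₂ => h₂.trans h₁⟩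
      haveI : Std.Irrefl (α := {v : EuclideanSpace ℝ (Fin n) // v ∈ P ∧ IsExposed ℝ P {v}})
        (fun x y => g y < g x) := ⟨fun _ => lt_irrefl _⟩
      Finite.wellFounded_of_trans_of_irrefl _
    intro v
    induction v using hwf.induction with
    | _ v ih =>
      intro hv
      by_cases hvm : v = m
      · subst hvm
        exact ⟨.nil, by simpa using hv⟩
      · have hlt : g v < g m := (hm v (Finset.mem_univ v)).lt_of_ne fun h =>
          hvm (Subtype.ext (hginj (hmem v) (hmem m) h))
        obtain ⟨w, hvw, hw⟩ := hP.exists_adj_of_lt g hlt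
        obtain ⟨p, hp⟩ := ih w hw (hv.trans_le (hle v w hw.le))
        exact ⟨.cons hvw p, fun x hx => by
          rw [SimpleGraph.Walk.support_cons, List.mem_cons] at hx
          rcases hx with rfl | hx
          exacts [hv, hp x hx]⟩
  have hweak : ∀ v : {v : EuclideanSpace ℝ (Fin n) // v ∈ P ∧ IsExposed ℝ P {v}}, c ≤ f v →
      ∃ p : (polytopeGraph P).Walk v m, ∀ x ∈ p.support, x = v ∨ c < f x := by
    intro v hv
    rcases hv.lt_or_eq with hv | hv
    · obtain ⟨p, hp⟩ := hstrict v hv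
      exact ⟨p, fun x hx => Or.inr (hp x hx)⟩
    -- On the hyperplane the first pivot uses `f` itself: an ascent of `g` could stay at level `c`.
    · obtain ⟨w, hvw, hw⟩ := hP.exists_adj_of_lt f (hv ▸ hu)
      obtain ⟨p, hp⟩ := hstrict w (hv ▸ hw)
      refine ⟨.cons hvw p, fun x hx => ?_⟩
      rw [SimpleGraph.Walk.support_cons, List.mem_cons] at hx
      exact hx.imp id (hp x)
  obtain ⟨p, hp⟩ := hweak s hs
  obtain ⟨p', hp'⟩ := hweak t ht
  refine ⟨(p.append p'.reverse).bypass, SimpleGraph.Walk.bypass_isPath _, fun x hx => ?_⟩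
  have hx' := SimpleGraph.Walk.support_bypass_subset_support _ hx
  rw [SimpleGraph.Walk.mem_support_append_iff, SimpleGraph.Walk.support_reverse,
    List.mem_reverse] at hx'
  rcases hx' with hx' | hx'
  · exact (hp x hx').imp id Or.inr
  · exact Or.inr (hp' x hx')

end Graph

/-! ### Separating two pairs of vertices -/

section Separation

variable {E : Type*} [NormedAddCommGroup E] [NormedSpace ℝ E] [FiniteDimensional ℝ E]

/-- If the span of differences of a finite set has dimension at least four and two segments
intersect in an inner point of the second one, some hyperplane contains both segments and properly splits the set. -/
theorem exists_splitting_hyperplane (V : Finset E)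
    (hV : 3 < Module.finrank ℝ (vectorSpan ℝ (V : Set E))) {a b a' b' : E} (ha : a ∈ V)
    (hmem : (segment ℝ a b ∩ openSegment ℝ a' b').Nonempty) :
    ∃ (f : StrongDual ℝ E) (c : ℝ), f a = c ∧ f b = c ∧ f a' = c ∧ f b' = c ∧
      (∃ u ∈ V, c < f u) ∧ ∃ u ∈ V, f u < c := by
  classical
  -- If `f z = 0`, the mean of `f` over `V` is `f a`. No generator `b' - a` is needed: the
  -- intersection point determines `f b'`.
  set z : E := ∑ v ∈ V, (v - a) with hz
  let D : Finset E := {b - a, a' - a, z}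
  have hD : Module.finrank ℝ (Submodule.span ℝ (D : Set E)) ≤ 3 :=
    (finrank_span_finset_le_card D).trans Finset.card_le_three
  obtain ⟨v, hvV, hv⟩ : ∃ v ∈ V, v - a ∉ Submodule.span ℝ (D : Set E) := by
    by_contra! h
    have hle : vectorSpan ℝ (V : Set E) ≤ Submodule.span ℝ (D : Set E) := by
      rw [vectorSpan_eq_span_vsub_set_right ℝ (Finset.mem_coe.2 ha), Submodule.span_le]
      rintro _ ⟨w, hw, rfl⟩
      exact h w hw
    exact absurd (Submodule.finrank_mono hle) (by omega)
  obtain ⟨f₀, hf₀v, hf₀⟩ := Submodule.exists_le_ker_of_notMem hv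
  let f : StrongDual ℝ E := LinearMap.toContinuousLinearMap f₀
  have hker : ∀ d ∈ D, f d = 0 := fun d hd => hf₀ (Submodule.subset_span (Finset.mem_coe.2 hd))
  have hb : f b = f a := by
    simpa [sub_eq_zero] using hker (b - a) (by simp [D])
  have ha' : f a' = f a := by
    simpa [sub_eq_zero] using hker (a' - a) (by simp [D])
  have hb' : f b' = f a := by
    obtain ⟨y, ⟨r, s, -, -, hrs, rfl⟩, r', s', -, hs', hrs', hy⟩ := hmem
    have h := congrArg f hy
    simp only [map_add, map_smul, smul_eq_mul, hb, ha'] at h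
    have : s' * (f b' - f a) = 0 := by linear_combination h + f a * (hrs - hrs')
    exact sub_eq_zero.1 ((mul_eq_zero.1 this).resolve_left hs'.ne')
  have hsum : ∑ v ∈ V, (f v - f a) = 0 := by
    simpa [hz, map_sum] using hker z (by simp [D])
  have hvne : f v - f a ≠ 0 := by
    rw [← map_sub]
    exact hf₀v
  obtain ⟨u, hu, hu0⟩ := Finset.exists_pos_of_sum_zero_of_exists_nonzero _ hsum ⟨v, hvV, hvne⟩
  obtain ⟨u', hu', hu0'⟩ := Finset.exists_pos_of_sum_zero_of_exists_nonzero (s := V)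
    (fun v => -(f v - f a)) (by rw [Finset.sum_neg_distrib, hsum, neg_zero])
    ⟨v, hvV, neg_ne_zero.2 hvne⟩
  exact ⟨f, f a, rfl, hb, ha', hb', ⟨u, hu, by linarith⟩, u', hu', by linarith⟩

/-- Two pairs of extreme points with no common point of a polytope of dimension at least four are
weakly separated by a hyperplane that is not supporting. -/
theorem exists_separating_hyperplane {P : Set E} (V : Finset E)
    (hVP : (V : Set E) = P.extremePoints ℝ)
    (hV : 3 < Module.finrank ℝ (vectorSpan ℝ (V : Set E))) {a b a' b' : E} (ha : a ∈ V)
    (hb : b ∈ V) (ha' : a' ∈ V) (hb' : b' ∈ V)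
    (haa' : a ≠ a') (hab' : a ≠ b') (hba' : b ≠ a') (hbb' : b ≠ b') :
    ∃ (f : StrongDual ℝ E) (c : ℝ), c ≤ f a ∧ c ≤ f b ∧ f a' ≤ c ∧ f b' ≤ c ∧
      (∃ u ∈ V, c < f u) ∧ ∃ u ∈ V, f u < c := by
  have hext : ∀ x ∈ V, x ∈ P.extremePoints ℝ := fun x hx => hVP ▸ Finset.mem_coe.2 hx
  by_cases hdisj : Disjoint (segment ℝ a' b') (segment ℝ a b)
  · have hcomp : ∀ x y : E, IsCompact (segment ℝ x y) := fun x y => by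
      rw [← convexHull_pair]
      exact (Set.toFinite {x, y}).isCompact_convexHull ℝ
    obtain ⟨f, r, s, hr, hrs, hs⟩ := geometric_hahn_banach_compact_closed (convex_segment a' b')
      (hcomp a' b') (convex_segment a b) (hcomp a b).isClosed hdisj
    have h1 := hr a' (left_mem_segment ℝ _ _)
    have h2 := hr b' (right_mem_segment ℝ _ _)
    have h3 := hs a (left_mem_segment ℝ _ _)
    have h4 := hs b (right_mem_segment ℝ _ _)
    exact ⟨f, r, by linarith, by linarith, h1.le, h2.le, ⟨a, ha, by linarith⟩, a', ha', h1⟩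
  · obtain ⟨y, hy', hy⟩ := Set.not_disjoint_iff.1 hdisj
    -- An extreme point lies on `[a, b]` only as an endpoint, so `y` is interior to `[a', b']`.
    have hends : ∀ x ∈ V, x ≠ a → x ≠ b → x ≠ y := by
      rintro x hx hxa hxb rfl
      rcases (mem_extremePoints_iff_forall_segment.1 (hext x hx)).2 a (hext a ha).1 b
        (hext b hb).1 hy with h | h
      exacts [hxa h.symm, hxb h.symm]
    have hyo : y ∈ openSegment ℝ a' b' := mem_openSegment_of_ne_left_right
      (hends a' ha' haa'.symm hba'.symm) (hends b' hb' hab'.symm hbb'.symm) hy'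
    obtain ⟨f, c, h1, h2, h3, h4, h5⟩ := exists_splitting_hyperplane V hV ha ⟨y, hy, hyo⟩
    exact ⟨f, c, h1.ge, h2.ge, h3.le, h4.le, h5⟩

end Separation

theorem mainTheorem8 (n : ℕ) (P : Set (EuclideanSpace ℝ (Fin n))) (hP : IsDPolytope 4 P) :
    (polytopeGraph P).IsKLinked 2 := by
  classical
  obtain ⟨hPoly, -, hdim⟩ := hP
  obtain ⟨S, hS⟩ := id hPoly
  have hfin : (P.extremePoints ℝ).Finite :=
    S.finite_toSet.subset (hS ▸ extremePoints_convexHull_subset)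
  have hconv : Convex ℝ P := hS ▸ convex_convexHull ℝ _
  have hcomp : IsCompact P := hS ▸ S.finite_toSet.isCompact_convexHull ℝ
  let V := hfin.toFinset
  have hVP : (V : Set (EuclideanSpace ℝ (Fin n))) = P.extremePoints ℝ := hfin.coe_toFinset
  have hVmem : ∀ x, x ∈ V ↔ x ∈ P ∧ IsExposed ℝ P {x} := fun x => by
    rw [hPoly.mem_vertices_iff, ← hVP, Finset.mem_coe]
  have hspan : Module.finrank ℝ (vectorSpan ℝ (V : Set (EuclideanSpace ℝ (Fin n)))) = 4 := by
    have hull : convexHull ℝ (P.extremePoints ℝ) = P := by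
      rw [← (hfin.isClosed_convexHull ℝ).closure_eq, closure_convexHull_extremePoints hcomp hconv]
    rw [← direction_affineSpan, ← affineSpan_convexHull, hVP, hull, hdim]
  refine ⟨?_, fun s t hst => ?_⟩
  · have hcard : 4 ≤ V.card := by
      by_contra! hlt
      have hVne : V.Nonempty := by
        rw [Finset.nonempty_iff_ne_empty]
        intro h
        rw [h, Finset.coe_empty, vectorSpan_empty, finrank_bot] at hspan
        omega
      have := finrank_vectorSpan_image_finset_le ℝ id V (n := V.card - 1)
        (by have := hVne.card_pos; omega)
      rw [Finset.image_id, hspan] at this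
      omega
    have := hPoly.finite_vertices
    rw [ENat.card_eq_coe_natCard]
    have hN : Nat.card {v // v ∈ P ∧ IsExposed ℝ P {v}} = V.card := by
      rw [← Nat.card_eq_finsetCard]
      exact Nat.card_congr (Equiv.subtypeEquivRight fun x => (hVmem x).symm)
    rw [hN]
    exact_mod_cast hcard
  · have hss : ∀ i j, i ≠ j → s i ≠ s j := fun i j hij h =>
      hij (Sum.inl_injective (hst (a₁ := .inl i) (a₂ := .inl j) h))
    have htt : ∀ i j, i ≠ j → t i ≠ t j := fun i j hij h =>
      hij (Sum.inr_injective (hst (a₁ := .inr i) (a₂ := .inr j) h))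
    have hsT : ∀ i j, s i ≠ t j := fun i j h =>
      Sum.inl_ne_inr (hst (a₁ := .inl i) (a₂ := .inr j) h)
    have hv : ∀ {x y : {v // v ∈ P ∧ IsExposed ℝ P {v}}}, x ≠ y → x.1 ≠ y.1 :=
      fun h h' => h (Subtype.ext h')
    have h01 : (0 : Fin 2) ≠ 1 := by decide
    obtain ⟨f, c, h1, h2, h3, h4, ⟨u, hu, hcu⟩, u', hu', hcu'⟩ :=
      exists_separating_hyperplane V hVP (by omega) ((hVmem _).2 (s 0).2) ((hVmem _).2 (t 0).2)
        ((hVmem _).2 (s 1).2) ((hVmem _).2 (t 1).2) (hv (hss 0 1 h01)) (hv (hsT 0 1))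
        (hv (hsT 1 0).symm) (hv (htt 0 1 h01))
    obtain ⟨p, hp, hpf⟩ := hPoly.exists_isPath_halfSpace f c (u := ⟨u, (hVmem u).1 hu⟩) h1 h2 hcu
    obtain ⟨p', hp', hpf'⟩ := hPoly.exists_isPath_halfSpace (-f) (-c)
      (s := s 1) (t := t 1) (u := ⟨u', (hVmem u').1 hu'⟩) (by simpa using h3) (by simpa using h4)
      (by simpa using hcu')
    have hpp' : List.Disjoint p.support p'.support := by
      intro x hx hx'
      have hf' : x = s 1 ∨ x = t 1 ∨ f x < c := by simpa using hpf' x hx'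
      rcases hpf x hx with rfl | rfl | h
      · rcases hf' with h' | h' | h'
        exacts [hss 0 1 h01 h', hsT 0 1 h', h'.not_ge h1]
      · rcases hf' with h' | h' | h'
        exacts [hsT 1 0 h'.symm, htt 0 1 h01 h', h'.not_ge h2]
      · rcases hf' with rfl | rfl | h'
        exacts [h.not_ge h3, h.not_ge h4, h.not_gt h']
    refine ⟨Fin.cons p (Fin.cons p' finZeroElim), Fin.forall_fin_two.2 ⟨hp, hp'⟩,
      Fin.forall_fin_two.2 ⟨Fin.forall_fin_two.2 ⟨fun h => absurd rfl h, fun _ => hpp'⟩,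
        Fin.forall_fin_two.2 ⟨fun _ => hpp'.symm, fun h => absurd rfl h⟩⟩⟩
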